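/- Let $n\ge 2$ and let $\mathcal S_r(\mathbb R^{n-1}\times\mathbb R^{n-1})$ be the set of Schwartz functions $f:\mathbb R^{n-1}\times\mathbb R^{n-1}\to\mathbb C$ such that $f(x,y)=f(x,Uy)$ for all $x,y\in\mathbb R^{n-1}$ and all orthogonal transformations $U$ of $\mathbb R^{n-1}$. For such $f$ define the cone transform $$Cf(u,v)=\int_{\mathbb R^{n-1}} f(u+|v|y,\,y)\,dy,\qquad (u,v)\in\mathbb R^{n-1}\times\mathbb R^{n-1},$$ and for a function $\mathbf f$ on $\mathbb R^{n-1}\times[0,\infty)$ define $$\mathcal C\mathbf f(u,s)=\int_{S^{n-2}}\int_0^\infty \mathbf f(u+zs\theta,\,z)\,z^{n-2}\,dz\,dS(\theta),\qquad (u,s)\in\mathbb R^{n-1}\times[0,\infty),$$ where $dS$ is the standard surface measure on the unit sphere $S^{n-2}\subset\mathbb R^{n-1}$ (for $n=2$, the counting measure on $S^0=\{1,-1\}$, so that $\mathcal C\mathbf f(u,s)=\int_0^\infty \mathbf f(u+zs,z)+\mathbf f(u-zs,z)\,dz$). Let $f\in\mathcal S_r(\mathbb R^{n-1}\times\mathbb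 R^{n-1})$. Then $Cf(u,v)=0$ for all $u,v\in\mathbb R^{n-1}$ with $|u|>\sqrt{1+|v|^2}$ if and only if $f(x,y)=0$ for all $x,y\in\mathbb R^{n-1}$ with $|x|^2+|y|^2>1$. Moreover, if $\mathbf f$ is the function on $\mathbb R^{n-1}\times[0,\infty)$ with $\mathbf f(x,|y|)=f(x,y)$ for all $x,y\in\mathbb R^{n-1}$, then $\mathcal C\mathbf f(u,s)=0$ for all $u\in\mathbb R^{n-1}$, $s\ge 0$ with $|u|>\sqrt{1+s^2}$ if and only if $\mathbf f(x,z)=0$ for all $x\in\mathbb R^{n-1}$, $z\ge 0$ with $|x|^2+z^2>1$. -/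

import Mathlib

open MeasureTheory

/-- The Euclidean space `ℝ^{n-1}`. -/
abbrev EucSpace (n : ℕ) : Type := EuclideanSpace ℝ (Fin (n - 1))

/-- `𝓢_r(ℝ^{n-1} × ℝ^{n-1})`: the Schwartz functions `f` with `f (x, y) = f (x, U y)` for all
`x`, `y` and all orthogonal transformations `U` of `ℝ^{n-1}`. -/
def radialSchwartz (n : ℕ) : Set (SchwartzMap (EucSpace n × EucSpace n) ℂ) :=
  {f | ∀ (U : EucSpace n ≃ₗᵢ[ℝ] EucSpace n) (x y : EucSpace n), f (x, y) = f (x, U y)}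

/-- The cone transform `C f (u, v) = ∫_{ℝ^{n-1}} f (u + |v| y, y) dy`. -/
noncomputable def coneTransform (n : ℕ) (f : EucSpace n × EucSpace n → ℂ) (u v : EucSpace n) : ℂ :=
  ∫ y : EucSpace n, f (u + ‖v‖ • y, y)

/-- The cone transform of a function on the half space,
`𝒞 g (u, s) = ∫_{S^{n-2}} ∫_0^∞ g (u + z s θ, z) z^{n-2} dz dS(θ)`.
Here `volume.toSphere` is the standard surface measure on the unit sphere of `ℝ^{n-1}`; for `n = 2`
it is the counting measure on `S^0 = {1, -1}`, see `halfSpaceConeTransform_two`. -/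
noncomputable def halfSpaceConeTransform (n : ℕ) (g : EucSpace n × ℝ → ℂ) (u : EucSpace n) (s : ℝ) :
    ℂ :=
  ∫ θ : Metric.sphere (0 : EucSpace n) 1,
    (∫ z in Set.Ioi (0 : ℝ), g (u + (z * s) • (θ : EucSpace n), z) * (z : ℂ) ^ (n - 2))
    ∂((volume : Measure (EucSpace n)).toSphere)

open scoped Pointwise in
/-- On the line, the surface measure of the unit sphere is the counting measure on `{1, -1}`. -/
theorem toSphere_two (θ : Metric.sphere (0 : EucSpace 2) 1) :
    (volume : Measure (EucSpace 2)).toSphere {θ} = 1 := by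
  have h1 : ∀ x : EucSpace 2, ‖x‖ = |x (0 : Fin 1)| := fun x => by
    rw [EuclideanSpace.norm_eq]
    simp [Real.sqrt_sq_eq_abs]
  have hθ : |(θ : EucSpace 2) (0 : Fin 1)| = 1 := by
    rw [← h1]
    simp
  have hmp : MeasurePreserving (fun x : EucSpace 2 => x (0 : Fin 1)) volume volume :=
    (volume_preserving_funUnique (Fin 1) ℝ).comp (PiLp.volume_preserving_ofLp (Fin 1))
  have hset : Set.Ioo (0 : ℝ) 1 • (((↑) : _ → EucSpace 2) '' {θ}) =
      (fun x : EucSpace 2 => x (0 : Fin 1)) ⁻¹'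
        {t | t * (θ : EucSpace 2) (0 : Fin 1) ∈ Set.Ioo (0 : ℝ) 1} := by
    have hsq : (θ : EucSpace 2) (0 : Fin 1) * (θ : EucSpace 2) (0 : Fin 1) = 1 := by
      rw [← abs_mul_abs_self, hθ, one_mul]
    ext x
    simp only [Set.image_singleton, Set.smul_singleton, Set.mem_image, Set.mem_preimage,
      Set.mem_ofPred_eq]
    constructor
    · rintro ⟨r, hr, rfl⟩
      have : (r • (θ : EucSpace 2)) (0 : Fin 1) * (θ : EucSpace 2) (0 : Fin 1) = r := by
        rw [PiLp.smul_apply, smul_eq_mul, mul_assoc, hsq, mul_one]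
      rwa [this]
    · intro hx
      refine ⟨_, hx, ?_⟩
      ext i
      obtain rfl : i = (0 : Fin 1) := Subsingleton.elim (α := Fin 1) _ _
      rw [PiLp.smul_apply, smul_eq_mul, mul_assoc, hsq, mul_one]
  have hvol : volume {t : ℝ | t * (θ : EucSpace 2) (0 : Fin 1) ∈ Set.Ioo (0 : ℝ) 1} = 1 := by
    rcases eq_or_eq_neg_of_abs_eq hθ with h | h
    · rw [h]
      have : {t : ℝ | t * 1 ∈ Set.Ioo (0 : ℝ) 1} = Set.Ioo 0 1 := by
        ext t
        simp
      rw [this]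
      simp
    · rw [h]
      have : {t : ℝ | t * -1 ∈ Set.Ioo (0 : ℝ) 1} = Set.Ioo (-1) 0 := by
        ext t
        simp only [Set.mem_ofPred_eq, Set.mem_Ioo]
        constructor <;> rintro ⟨h1, h2⟩ <;> constructor <;> linarith
      rw [this]
      simp
  have hms : MeasurableSet {t : ℝ | t * (θ : EucSpace 2) (0 : Fin 1) ∈ Set.Ioo (0 : ℝ) 1} :=
    (measurable_id.mul_const _) measurableSet_Ioo
  rw [Measure.toSphere_apply' _ (measurableSet_singleton θ), hset,
    hmp.measure_preimage hms.nullMeasurableSet, hvol]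
  simp

/-- For `n = 2` the transform on the half space is
`𝒞 g (u, s) = ∫_0^∞ g (u + z s, z) + g (u - z s, z) dz`. -/
theorem halfSpaceConeTransform_two (g : EucSpace 2 × ℝ → ℂ) (u : EucSpace 2) (s : ℝ)
    (e : EucSpace 2) (he : ‖e‖ = 1) :
    halfSpaceConeTransform 2 g u s =
      (∫ z in Set.Ioi (0 : ℝ), g (u + (z * s) • e, z)) +
        ∫ z in Set.Ioi (0 : ℝ), g (u - (z * s) • e, z) := by
  have h1 : ∀ x : EucSpace 2, ‖x‖ = |x (0 : Fin 1)| := fun x => by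
    rw [EuclideanSpace.norm_eq]
    simp [Real.sqrt_sq_eq_abs]
  let p : Metric.sphere (0 : EucSpace 2) 1 := ⟨e, by simpa using he⟩
  let q : Metric.sphere (0 : EucSpace 2) 1 := ⟨-e, by simpa using he⟩
  have hpq : p ≠ q := by
    intro h
    have h2 : e = -e := congrArg Subtype.val h
    have h3 : e (0 : Fin 1) = -e (0 : Fin 1) := congrArg (fun x : EucSpace 2 => x (0 : Fin 1)) h2
    rw [h1, show e (0 : Fin 1) = 0 by linarith] at he
    simp at he
  have hall : ∀ x : Metric.sphere (0 : EucSpace 2) 1, x = p ∨ x = q := by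
    intro x
    have hx : ‖(x : EucSpace 2)‖ = ‖e‖ := by
      rw [he]
      simp
    rw [h1, h1, abs_eq_abs] at hx
    rcases hx with hx | hx
    · left
      ext i
      obtain rfl : i = (0 : Fin 1) := Subsingleton.elim (α := Fin 1) _ _
      exact hx
    · right
      ext i
      obtain rfl : i = (0 : Fin 1) := Subsingleton.elim (α := Fin 1) _ _
      exact hx
  have hfin : Finite (Metric.sphere (0 : EucSpace 2) 1) :=
    Set.finite_univ_iff.mp ((Set.toFinite {p, q}).subset fun x _ => hall x)
  have hmeas : (volume : Measure (EucSpace 2)).toSphere = Measure.dirac p + Measure.dirac q := by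
    refine Measure.ext_of_singleton fun x => ?_
    rw [toSphere_two]
    rcases hall x with rfl | rfl
    · simp [hpq.symm]
    · simp [hpq]
  rw [halfSpaceConeTransform, hmeas, integral_add_measure Integrable.of_finite
    Integrable.of_finite, integral_dirac, integral_dirac]
  simp [p, q, sub_eq_add_neg]

/-!
Write `V = ℝ^{n-1}` and `m = n - 1`, and let `V × V = ℝ^{2m}` carry its Euclidean norm. By Fubini and
the invariance of `f` under rotations of the second variable, the integral of `C f (·, v)` against a
function of `⟪u, a⟫` is the integral of `f` against a plane wave with frequency `(a, b)`, where
`‖b‖ = ‖v‖ ‖a‖` (`integral_wave_eq_integral_wave_cone`). The vanishing of `C f (u, v)` for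
`‖u‖ > √(1 + ‖v‖²)` therefore says that `f` is annihilated by the plane waves `ψ ⟪z, ω⟫` with
`ψ = 0` on `(-∞, 1]` and `‖ω‖ < 1`, that is, that the Radon transform of `f` vanishes on the
hyperplanes that miss the closed unit ball. What remains is Helgason's support theorem for Schwartz
functions in even dimension, `schwartzMap_eq_zero_of_forall_wave_eq_zero`. Its proof has three steps.

* Differentiating in the frequency multiplies `f` by linear functions and replaces `ψ` by `ψ'`.
  As `f` decays rapidly, `ψ` may grow polynomially, so every admissible profile is the derivative of
  an admissible one. Hence `f` may be replaced by `⟪z, ξ⟫^k f`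
  (`integral_wave_inner_pow_smul_eq_zero`).
* Averaging the waves over `ω` in the unit ball with weight `√(1 - ‖ω‖²)` gives the radial
  functions `c ∫_{-1}^1 (1 - t²)^m ψ (‖z‖ t) dt` (`integral_sqrt_mul_wave`). The exponent `m` is an
  integer because the dimension is even, so Taylor's formula with integral remainder produces a
  profile `ψ` for every radial bump supported in `‖z‖ > 1` (`exists_isWaveProfile_integral_eq`).
* So for a radial bump `Φ` supported outside the closed unit ball all moments of `Φ f` vanish. A
  compactly supported continuous function with vanishing moments is zero, because its Fourier
  transform is (`eq_zero_of_forall_integral_inner_pow_eq_zero`).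

Conversely, if `f` is supported in the closed unit ball, the domains of integration miss its support
by the Cauchy-Schwarz inequality. The transform on the half space is the cone transform in polar
coordinates (`halfSpaceConeTransform_eq_integral_cone`).
-/

/-! ### One-sided profiles on the line -/

/-- The profiles `ψ` of the plane waves `z ↦ ψ ⟪z, ω⟫`: continuous functions on the line which
vanish on `(-∞, 1]` and grow at most polynomially. No decay is asked for, so that the class is
stable under taking antiderivatives. -/
structure IsWaveProfile (ψ : ℝ → ℝ) : Prop where
  continuous : Continuous ψ
  eq_zero : ∀ s ≤ 1, ψ s = 0
  growth : ∃ (C : ℝ) (k : ℕ), 0 ≤ C ∧ ∀ s, |ψ s| ≤ C * (1 + |s|) ^ k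

namespace IsWaveProfile

theorem exists_antideriv {ψ : ℝ → ℝ} (hψ : IsWaveProfile ψ) :
    ∃ Ψ : ℝ → ℝ, IsWaveProfile Ψ ∧ ∀ s, HasDerivAt Ψ (ψ s) s := by
  have hd : ∀ s, HasDerivAt (fun s => ∫ x in (1 : ℝ)..s, ψ x) (ψ s) s := fun s =>
    intervalIntegral.integral_hasDerivAt_right (hψ.continuous.intervalIntegrable _ _)
      (hψ.continuous.stronglyMeasurableAtFilter _ _) hψ.continuous.continuousAt
  have h0 : ∀ s ≤ 1, ∫ x in (1 : ℝ)..s, ψ x = 0 := fun s hs => by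
    rw [intervalIntegral.integral_congr (g := fun _ => (0 : ℝ))]
    · simp
    · intro x hx
      rw [Set.uIcc_of_ge hs] at hx
      exact hψ.eq_zero x hx.2
  obtain ⟨C, k, hC, hb⟩ := hψ.growth
  refine ⟨_, ⟨continuous_iff_continuousAt.2 fun s => (hd s).continuousAt, h0,
    C, k + 1, hC, fun s => ?_⟩, hd⟩
  rcases le_total s 1 with hs | hs
  · rw [h0 s hs, abs_zero]
    positivity
  · have hle : ∀ x ∈ Set.uIoc 1 s, ‖ψ x‖ ≤ C * (1 + |s|) ^ k := fun x hx => by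
      rw [Set.uIoc_of_le hs] at hx
      refine (hb x).trans ?_
      have : |x| ≤ |s| := abs_le_abs_of_nonneg (by linarith [hx.1]) hx.2
      gcongr
    have := intervalIntegral.norm_integral_le_of_norm_le_const hle
    rw [Real.norm_eq_abs] at this
    refine this.trans ?_
    rw [pow_succ, ← mul_assoc]
    gcongr
    rw [abs_of_nonneg (by linarith), abs_of_nonneg (by linarith)]
    linarith

/-- For a Schwartz function `h`, the integrals of the plane waves with frequency in a fixed ball
against `h` have a common integrable majorant. -/
theorem exists_bound {F : Type*} [NormedAddCommGroup F] [InnerProductSpace ℝ F]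
    [FiniteDimensional ℝ F] [MeasurableSpace F] [BorelSpace F]
    {ψ : ℝ → ℝ} (hψ : IsWaveProfile ψ) (h : SchwartzMap F ℂ) (R : ℝ) :
    ∃ b : F → ℝ, Integrable b ∧ ∀ z ω, ‖ω‖ ≤ R → ‖ψ (inner ℝ z ω) • h z‖ ≤ b z := by
  obtain ⟨C, k, hC, hb⟩ := hψ.growth
  refine ⟨fun z => C * (1 + |R|) ^ k * (2 ^ (k - 1) * (‖z‖ ^ 0 * ‖h z‖ + ‖z‖ ^ k * ‖h z‖)),
    (((h.integrable_pow_mul volume 0).add (h.integrable_pow_mul volume k)).const_mul _).const_mul _,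
    fun z ω hω => ?_⟩
  have h1 : |inner ℝ z ω| ≤ ‖z‖ * |R| :=
    (abs_real_inner_le_norm z ω).trans (by gcongr; exact hω.trans (le_abs_self R))
  have h2 : (1 + ‖z‖) ^ k ≤ 2 ^ (k - 1) * (1 ^ k + ‖z‖ ^ k) :=
    add_pow_le zero_le_one (norm_nonneg z) k
  calc ‖ψ (inner ℝ z ω) • h z‖ = |ψ (inner ℝ z ω)| * ‖h z‖ := by
        rw [norm_smul, Real.norm_eq_abs]
    _ ≤ C * (1 + |inner ℝ z ω|) ^ k * ‖h z‖ := by gcongr; exact hb _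
    _ ≤ C * ((1 + |R|) * (1 + ‖z‖)) ^ k * ‖h z‖ := by
        gcongr
        nlinarith [abs_nonneg R, norm_nonneg z]
    _ = C * (1 + |R|) ^ k * ((1 + ‖z‖) ^ k * ‖h z‖) := by rw [mul_pow]; ring
    _ ≤ C * (1 + |R|) ^ k * (2 ^ (k - 1) * (1 ^ k + ‖z‖ ^ k) * ‖h z‖) := by gcongr
    _ = _ := by ring

theorem integrable_smul {F : Type*} [NormedAddCommGroup F] [InnerProductSpace ℝ F]
    [FiniteDimensional ℝ F] [MeasurableSpace F] [BorelSpace F]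
    {ψ : ℝ → ℝ} (hψ : IsWaveProfile ψ) (h : SchwartzMap F ℂ) (ω : F) :
    Integrable fun z => ψ (inner ℝ z ω) • h z := by
  obtain ⟨b, hb, hle⟩ := hψ.exists_bound h ‖ω‖
  refine hb.mono' ?_ (Filter.Eventually.of_forall fun z => hle z ω le_rfl)
  exact ((hψ.continuous.comp (by fun_prop)).smul h.continuous).aestronglyMeasurable

end IsWaveProfile

theorem tsupport_iteratedDeriv_subset_tsupport (f : ℝ → ℝ) (k : ℕ) :
    tsupport (iteratedDeriv k f) ⊆ tsupport f := by
  induction k with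
  | zero => simp
  | succ k ih =>
    rw [iteratedDeriv_succ]
    exact (closure_minimal support_deriv_subset (isClosed_tsupport _)).trans ih

/-- Inversion of the Abel-type transform `ψ ↦ ∫_{-1}^1 (1 - t²)^m ψ (r t) dt`: every `C^{m+1}`
bump `β (r²)` supported in `r > 1` is attained, up to the factor `m! r^{-2m-1}`, by the profile
`ψ s = 2 s β^{(m+1)} (s²)`, `s > 0`. After the substitution `σ = (r t)²` this is Taylor's formula
with integral remainder for `β` at `0`. -/
theorem exists_isWaveProfile_integral_eq {β : ℝ → ℝ} {m : ℕ} (hβ : ContDiff ℝ (m + 1 : ℕ) β)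
    (hc : HasCompactSupport β) (hs : tsupport β ⊆ Set.Ioi 1) :
    ∃ ψ : ℝ → ℝ, IsWaveProfile ψ ∧ ∀ r : ℝ, 0 < r →
      ∫ t in (-1 : ℝ)..1, (1 - t ^ 2) ^ m * ψ (r * t) =
        (m.factorial : ℝ) * (r ^ (2 * m + 1))⁻¹ * β (r ^ 2) := by
  set χ := iteratedDeriv (m + 1) β with hχ
  have hχc : Continuous χ := hβ.continuous_iteratedDeriv _ le_rfl
  have hsupp : ∀ k, ∀ s ≤ 1, iteratedDeriv k β s = 0 := fun k s hs1 => by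
    by_contra hne
    have : s ∈ tsupport (iteratedDeriv k β) := subset_tsupport _ hne
    have h2 := hs (tsupport_iteratedDeriv_subset_tsupport β k this)
    exact absurd h2 (not_lt.2 hs1)
  have hχs : HasCompactSupport χ :=
    hc.mono' ((subset_tsupport _).trans (tsupport_iteratedDeriv_subset_tsupport β _))
  obtain ⟨M, hM⟩ := hχs.exists_bound_of_continuous hχc
  have hM0 : 0 ≤ M := (norm_nonneg _).trans (hM 0)
  refine ⟨fun s => 2 * max s 0 * χ (s ^ 2), ⟨by fun_prop, fun s hs1 => ?_, 2 * M, 1, by positivity,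
    fun s => ?_⟩, fun r hr => ?_⟩
  · rcases le_total s 0 with h | h
    · simp [max_eq_right h]
    · have : χ (s ^ 2) = 0 := hsupp _ _ (by nlinarith)
      rw [this, mul_zero]
  · have h1 := hM (s ^ 2)
    rw [Real.norm_eq_abs] at h1
    rw [abs_mul, abs_mul, abs_two, abs_of_nonneg (le_max_right s 0), pow_one]
    have h2 : max s 0 ≤ 1 + |s| :=
      max_le (by linarith [le_abs_self s]) (by positivity)
    calc 2 * max s 0 * |χ (s ^ 2)| ≤ 2 * (1 + |s|) * M := by gcongr
      _ = _ := by ring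
  · have hcont : Continuous fun t : ℝ => (1 - t ^ 2) ^ m * (2 * max (r * t) 0 * χ ((r * t) ^ 2)) := by
      fun_prop
    have hneg : ∫ t in (-1 : ℝ)..0, (1 - t ^ 2) ^ m * (2 * max (r * t) 0 * χ ((r * t) ^ 2)) = 0 := by
      rw [intervalIntegral.integral_congr (g := fun _ => (0 : ℝ))]
      · simp
      · intro t ht
        rw [Set.uIcc_of_le (by norm_num)] at ht
        have : r * t ≤ 0 := mul_nonpos_of_nonneg_of_nonpos hr.le ht.2
        simp [max_eq_right this]
    rw [← intervalIntegral.integral_add_adjacent_intervals (hcont.intervalIntegrable (-1) 0)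
      (hcont.intervalIntegrable 0 1), hneg, zero_add]
    have hsub : ∫ t in (0 : ℝ)..1, ((r ^ 2 - (r * t) ^ 2) ^ m * χ ((r * t) ^ 2)) * (2 * r ^ 2 * t) =
        ∫ σ in (0 : ℝ)..r ^ 2, (r ^ 2 - σ) ^ m * χ σ := by
      have := intervalIntegral.integral_comp_mul_deriv (a := 0) (b := 1)
        (f := fun t => (r * t) ^ 2) (f' := fun t => 2 * r ^ 2 * t)
        (g := fun σ => (r ^ 2 - σ) ^ m * χ σ) (fun t _ => by
          have := ((hasDerivAt_id t).const_mul r).pow 2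
          convert! this using 1
          simp
          ring) (by fun_prop) (by fun_prop)
      simpa using this
    have hT : ∫ σ in (0 : ℝ)..r ^ 2, (r ^ 2 - σ) ^ m * χ σ = m.factorial * β (r ^ 2) := by
      have h0 : (0 : ℝ) < r ^ 2 := by positivity
      have hu : UniqueDiffOn ℝ (Set.uIcc 0 (r ^ 2)) := uniqueDiffOn_uIcc h0.ne
      have hw : ∀ k ≤ m + 1, ∀ t ∈ Set.uIcc 0 (r ^ 2),
          iteratedDerivWithin k β (Set.uIcc 0 (r ^ 2)) t = iteratedDeriv k β t := fun k hk t ht =>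
        iteratedDerivWithin_eq_iteratedDeriv hu
          ((hβ.of_le (by exact_mod_cast hk)).contDiffAt) ht
      have := taylor_integral_remainder (n := m) (hβ.contDiffOn (s := Set.uIcc 0 (r ^ 2)))
      -- The Taylor polynomial at `0` vanishes because `β` does near `0`.
      have hz : taylorWithinEval β m (Set.uIcc 0 (r ^ 2)) 0 (r ^ 2) = 0 := by
        rw [taylor_within_apply]
        refine Finset.sum_eq_zero fun k hk => ?_
        rw [hw k (by simp at hk; omega) 0 Set.left_mem_uIcc, hsupp k 0 zero_le_one, smul_zero]
      rw [hz, sub_zero] at this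
      rw [this, ← intervalIntegral.integral_const_mul]
      refine intervalIntegral.integral_congr fun t ht => ?_
      simp only [smul_eq_mul]
      rw [hw _ le_rfl t ht]
      have : (m.factorial : ℝ) ≠ 0 := by positivity
      field_simp
      rw [hχ]
    rw [hT] at hsub
    rw [mul_right_comm, ← hsub, mul_comm, ← intervalIntegral.integral_const_mul]
    refine intervalIntegral.integral_congr fun t ht => ?_
    rw [Set.uIcc_of_le zero_le_one] at ht
    have : 0 ≤ r * t := mul_nonneg hr.le ht.1
    simp only [max_eq_left this]
    have : r ^ 2 - (r * t) ^ 2 = r ^ 2 * (1 - t ^ 2) := by ring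
    rw [this, mul_pow (r ^ 2), ← pow_mul, pow_succ]
    field_simp
    ring

/-! ### Moments -/

section Moments

variable {F : Type*} [NormedAddCommGroup F] [InnerProductSpace ℝ F]
    [FiniteDimensional ℝ F] [MeasurableSpace F] [BorelSpace F]

open scoped FourierTransform in
/-- The moments in all directions determine a compactly supported continuous function: they are
the coefficients of the power series of its Fourier transform. -/
theorem eq_zero_of_forall_integral_inner_pow_eq_zero {G : F → ℂ} (hG : Continuous G)
    (hc : HasCompactSupport G)
    (h0 : ∀ (ξ : F) (k : ℕ), ∫ z, ((inner ℝ z ξ : ℝ) : ℂ) ^ k * G z = 0) : G = 0 := by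
  have hint : Integrable G := hG.integrable_of_hasCompactSupport hc
  have hF : 𝓕 G = 0 := by
    ext ξ
    obtain ⟨R, hR⟩ := hc.isCompact.isBounded.exists_norm_le
    have hsum : HasSum (fun k : ℕ => ∫ z, (((-2 * Real.pi * inner ℝ z ξ : ℝ) : ℂ) * Complex.I) ^ k /
        (k.factorial : ℂ) * G z)
        (∫ z, Complex.exp (((-2 * Real.pi * inner ℝ z ξ : ℝ) : ℂ) * Complex.I) * G z) := by
      set A := 2 * Real.pi * |R| * ‖ξ‖ with hA
      refine hasSum_integral_of_dominated_convergence
        (fun k z => A ^ k / k.factorial * ‖G z‖) (fun k => ?_) (fun k => ?_) ?_ ?_ ?_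
      · exact (by fun_prop : Continuous fun z => (((-2 * Real.pi * inner ℝ z ξ : ℝ) : ℂ) *
          Complex.I) ^ k / (k.factorial : ℂ) * G z).aestronglyMeasurable
      · refine Filter.Eventually.of_forall fun z => ?_
        by_cases hz : G z = 0
        · simp [hz]
        have hzR := hR z (subset_tsupport _ hz)
        have h1 : ‖((-2 * Real.pi * inner ℝ z ξ : ℝ) : ℂ) * Complex.I‖ ≤ A := by
          rw [norm_mul, Complex.norm_I, mul_one, Complex.norm_real, Real.norm_eq_abs, abs_mul,
            abs_mul, abs_neg, abs_two, abs_of_pos Real.pi_pos, hA, mul_assoc _ |R|]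
          gcongr
          exact (abs_real_inner_le_norm z ξ).trans (by gcongr; exact hzR.trans (le_abs_self R))
        rw [norm_mul, norm_div, norm_pow, Complex.norm_natCast]
        gcongr
      · exact Filter.Eventually.of_forall fun z =>
          (Real.summable_pow_div_factorial A).mul_right _
      · simp_rw [tsum_mul_right]
        exact hint.norm.const_mul _
      · refine Filter.Eventually.of_forall fun z => HasSum.mul_right _ ?_
        rw [Complex.exp_eq_exp_ℂ]
        exact NormedSpace.expSeries_div_hasSum_exp _
    -- The `k`-th term of the series is a multiple of the `k`-th moment in the direction `ξ`.
    have hz : ∀ k : ℕ, ∫ z, (((-2 * Real.pi * inner ℝ z ξ : ℝ) : ℂ) * Complex.I) ^ k /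
        (k.factorial : ℂ) * G z = 0 := fun k => by
      have : ∀ z, (((-2 * Real.pi * inner ℝ z ξ : ℝ) : ℂ) * Complex.I) ^ k /
          (k.factorial : ℂ) * G z = ((-2 * Real.pi : ℝ) * Complex.I) ^ k / (k.factorial : ℂ) *
            (((inner ℝ z ξ : ℝ) : ℂ) ^ k * G z) := fun z => by
        push_cast
        ring
      simp_rw [this]
      rw [integral_const_mul, h0, mul_zero]
    simp_rw [hz] at hsum
    have := hsum.unique hasSum_zero
    rw [Real.fourier_eq']
    simpa using this
  have hinv := hG.fourierInv_fourier_eq hint (by rw [hF]; exact integrable_zero _ _ _)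
  rw [← hinv, hF]
  ext z
  simp [Real.fourierInv_eq']

/-- Differentiation of plane wave integrals in the direction `ξ` of the frequency: if all plane
waves with frequency in an open set annihilate `h`, they annihilate `⟪·, ξ⟫ h` as well. -/
theorem integral_wave_inner_smul_eq_zero {Ω : Set F} (hΩ : IsOpen Ω) {h₀ h₁ : SchwartzMap F ℂ}
    (ξ : F) (h₁₀ : ∀ z, h₁ z = inner ℝ z ξ • h₀ z)
    (H : ∀ ψ, IsWaveProfile ψ → ∀ ω ∈ Ω, ∫ z, ψ (inner ℝ z ω) • h₀ z = 0)
    {ψ : ℝ → ℝ} (hψ : IsWaveProfile ψ) {ω : F} (hω : ω ∈ Ω) :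
    ∫ z, ψ (inner ℝ z ω) • h₁ z = 0 := by
  obtain ⟨Ψ, hΨ, hd⟩ := hψ.exists_antideriv
  obtain ⟨b, hb, hle⟩ := hψ.exists_bound h₁ (‖ω‖ + ‖ξ‖)
  have key := hasDerivAt_integral_of_dominated_loc_of_deriv_le (μ := (volume : Measure F))
    (F := fun (t : ℝ) z => Ψ (inner ℝ z (ω + t • ξ)) • h₀ z)
    (F' := fun (t : ℝ) z => ψ (inner ℝ z (ω + t • ξ)) • h₁ z)
    (x₀ := 0) (s := Metric.ball 0 1) (bound := b) (Metric.ball_mem_nhds 0 one_pos)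
    (Filter.Eventually.of_forall fun t => (hΨ.integrable_smul h₀ _).aestronglyMeasurable)
    (hΨ.integrable_smul h₀ _) (hψ.integrable_smul h₁ _).aestronglyMeasurable
    (Filter.Eventually.of_forall fun z t ht => hle z _ ?_) hb
    (Filter.Eventually.of_forall fun z t _ => ?_)
  -- The frequency `ω + t ξ` stays in `Ω` for small `t`, so the differentiated function is locally `0`.
  · have hz : (fun t : ℝ => ∫ z, Ψ (inner ℝ z (ω + t • ξ)) • h₀ z) =ᶠ[nhds 0] fun _ => 0 := by
      have hcont : ContinuousAt (fun t : ℝ => ω + t • ξ) 0 := by fun_prop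
      filter_upwards [hcont.preimage_mem_nhds (hΩ.mem_nhds (by simpa using hω))] with t ht
      exact H Ψ hΨ _ ht
    have := key.2.unique ((hasDerivAt_const (0 : ℝ) (0 : ℂ)).congr_of_eventuallyEq hz)
    simpa using this
  · refine (norm_add_le _ _).trans ?_
    rw [norm_smul]
    have : ‖t‖ ≤ 1 := by simpa using (Metric.mem_ball.1 ht).le
    nlinarith [norm_nonneg ξ]
  · have h1 : HasDerivAt (fun t : ℝ => inner ℝ z (ω + t • ξ)) (inner ℝ z ξ) t := by
      simp_rw [inner_add_right, inner_smul_right]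
      simpa using ((hasDerivAt_id t).mul_const (inner ℝ z ξ)).const_add (inner ℝ z ω)
    have h2 := ((hd _).comp t h1).smul_const (h₀ z)
    rw [h₁₀, smul_smul]
    exact h2

theorem exists_schwartzMap_inner_pow_smul {F : Type*} [NormedAddCommGroup F]
    [InnerProductSpace ℝ F] (h : SchwartzMap F ℂ) (ξ : F) (k : ℕ) :
    ∃ g : SchwartzMap F ℂ, ∀ z, g z = inner ℝ z ξ ^ k • h z := by
  refine ⟨SchwartzMap.smulLeftCLM ℂ (fun z => inner ℝ z ξ ^ k) h, fun z => ?_⟩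
  exact SchwartzMap.smulLeftCLM_apply_apply (by fun_prop) h z

theorem integral_wave_inner_pow_smul_eq_zero {Ω : Set F} (hΩ : IsOpen Ω) {h : SchwartzMap F ℂ}
    (H : ∀ ψ, IsWaveProfile ψ → ∀ ω ∈ Ω, ∫ z, ψ (inner ℝ z ω) • h z = 0) (ξ : F) (k : ℕ)
    {g : SchwartzMap F ℂ} (hg : ∀ z, g z = inner ℝ z ξ ^ k • h z) {ψ : ℝ → ℝ}
    (hψ : IsWaveProfile ψ) {ω : F} (hω : ω ∈ Ω) : ∫ z, ψ (inner ℝ z ω) • g z = 0 := by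
  induction k generalizing g ψ ω with
  | zero => simpa [hg] using H ψ hψ ω hω
  | succ k ih =>
    obtain ⟨g', hg'⟩ := exists_schwartzMap_inner_pow_smul h ξ k
    refine integral_wave_inner_smul_eq_zero hΩ (h₀ := g') ξ (fun z => ?_)
      (fun ψ hψ ω hω => ih hg' hψ hω) hψ hω
    rw [hg, hg', smul_smul, pow_succ']

end Moments

/-! ### Averages of plane waves over the unit ball -/

/-- Slicing the weight `√(1 - ‖ω‖²)` of the unit ball of `ℝ^{2m}` by a hyperplane at height `t`.
The exponent `m` is an integer because the dimension is even. -/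
theorem integral_sqrt_one_sub_sq_sub_norm_sq {m : ℕ} (hm : 1 ≤ m) (t : ℝ) :
    ∫ w : EuclideanSpace ℝ (Fin (2 * m - 1)), √(1 - t ^ 2 - ‖w‖ ^ 2) =
      (Set.Ioo (-1 : ℝ) 1).indicator (fun t => (1 - t ^ 2) ^ m) t *
        ∫ w : EuclideanSpace ℝ (Fin (2 * m - 1)), √(1 - ‖w‖ ^ 2) := by
  by_cases ht : t ∈ Set.Ioo (-1 : ℝ) 1
  · rw [Set.indicator_of_mem ht]
    have hpos : 0 < 1 - t ^ 2 := by nlinarith [ht.1, ht.2]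
    set a := √(1 - t ^ 2) with ha
    have ha0 : 0 < a := Real.sqrt_pos.2 hpos
    have ha2 : a ^ 2 = 1 - t ^ 2 := Real.sq_sqrt hpos.le
    have h1 : ∀ w : EuclideanSpace ℝ (Fin (2 * m - 1)),
        √(1 - t ^ 2 - ‖w‖ ^ 2) = a * √(1 - ‖a⁻¹ • w‖ ^ 2) := fun w => by
      rw [ha, ← Real.sqrt_mul hpos.le, ← ha, norm_smul, norm_inv, Real.norm_eq_abs,
        abs_of_pos ha0, mul_pow, inv_pow, ha2]
      congr 1
      field_simp
    simp_rw [h1]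
    rw [integral_const_mul, Measure.integral_comp_inv_smul_of_nonneg volume
      (fun w : EuclideanSpace ℝ (Fin (2 * m - 1)) => √(1 - ‖w‖ ^ 2)) ha0.le,
      finrank_euclideanSpace_fin, smul_eq_mul, ← mul_assoc, ← pow_succ', ← ha2, ← pow_mul]
    congr 2
    omega
  · rw [Set.indicator_of_notMem ht, zero_mul]
    have hneg : 1 - t ^ 2 ≤ 0 := by
      by_contra h
      exact ht ⟨by nlinarith, by nlinarith⟩
    have h1 : ∀ w : EuclideanSpace ℝ (Fin (2 * m - 1)), √(1 - t ^ 2 - ‖w‖ ^ 2) = 0 := fun w =>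
      Real.sqrt_eq_zero_of_nonpos (by nlinarith [sq_nonneg ‖w‖])
    simp [h1]

theorem integral_sqrt_one_sub_norm_sq_pos (d : ℕ) :
    0 < ∫ w : EuclideanSpace ℝ (Fin d), √(1 - ‖w‖ ^ 2) := by
  have hcont : Continuous fun w : EuclideanSpace ℝ (Fin d) => √(1 - ‖w‖ ^ 2) := by fun_prop
  refine hcont.integral_pos_of_hasCompactSupport_nonneg_nonzero (x := 0)
    (HasCompactSupport.intro (isCompact_closedBall 0 1) fun w hw => ?_)
    (fun w => Real.sqrt_nonneg _) (by simp)
  have : 1 < ‖w‖ := by simpa using hw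
  exact Real.sqrt_eq_zero_of_nonpos (by nlinarith)

section Average

variable {F : Type*} [NormedAddCommGroup F] [InnerProductSpace ℝ F]
    [FiniteDimensional ℝ F] [MeasurableSpace F] [BorelSpace F]

/-- Cartesian coordinates adapted to a unit vector `e`: a measure preserving identification of
`ℝ × ℝ^d` with `F` whose first coordinate is `⟪e, ·⟫`. -/
theorem exists_measurableEquiv_prod_inner {d : ℕ} (hF : Module.finrank ℝ F = d + 1) {e : F}
    (he : ‖e‖ = 1) :
    ∃ T : ℝ × EuclideanSpace ℝ (Fin d) ≃ᵐ F, MeasurePreserving T ∧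
      ∀ p, ‖T p‖ ^ 2 = p.1 ^ 2 + ‖p.2‖ ^ 2 ∧ inner ℝ e (T p) = p.1 := by
  have he0 : e ≠ 0 := fun h => by simp [h] at he
  have hd : Module.finrank ℝ (ℝ ∙ e)ᗮ = d :=
    Submodule.finrank_add_finrank_orthogonal' (by rw [finrank_span_singleton he0, hF, add_comm])
  let L₁ : ℝ ≃ₗᵢ[ℝ] (ℝ ∙ e) := LinearIsometryEquiv.toSpanUnitSingleton e he
  let L₂ : EuclideanSpace ℝ (Fin d) ≃ₗᵢ[ℝ] (ℝ ∙ e)ᗮ :=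
    ((stdOrthonormalBasis ℝ (ℝ ∙ e)ᗮ).reindex (finCongr hd)).repr.symm
  let D := (ℝ ∙ e).orthogonalDecomposition.symm
  refine ⟨(MeasurableEquiv.prodCongr L₁.toMeasurableEquiv L₂.toMeasurableEquiv).trans
    ((MeasurableEquiv.toLp 2 ((ℝ ∙ e) × (ℝ ∙ e)ᗮ)).trans D.toMeasurableEquiv), ?_, fun p => ?_⟩
  · exact D.measurePreserving.comp ((WithLp.volume_preserving_toLp _ _).comp
      (L₁.measurePreserving.prod L₂.measurePreserving))
  · have hT : ((MeasurableEquiv.prodCongr L₁.toMeasurableEquiv L₂.toMeasurableEquiv).trans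
        ((MeasurableEquiv.toLp 2 ((ℝ ∙ e) × (ℝ ∙ e)ᗮ)).trans D.toMeasurableEquiv)) p =
        D (WithLp.toLp 2 (L₁ p.1, L₂ p.2)) := rfl
    rw [hT]
    constructor
    · rw [LinearIsometryEquiv.norm_map, WithLp.prod_norm_sq_eq_of_L2]
      simp
    · have h2 : inner ℝ e ((L₂ p.2 : (ℝ ∙ e)ᗮ) : F) = 0 :=
        (Submodule.mem_orthogonal_singleton_iff_inner_right).1 (L₂ p.2).2
      have h3 : D (WithLp.toLp 2 (L₁ p.1, L₂ p.2)) = p.1 • e + (L₂ p.2 : F) := by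
        simp [D, L₁, Submodule.orthogonalDecomposition_symm_apply]
      rw [h3, inner_add_right, h2, inner_smul_right, real_inner_self_eq_norm_sq, he]
      simp

/-- In even dimension `2m` the average of a plane wave over the unit ball with weight
`√(1 - ‖ω‖²)` has the polynomial marginal `(1 - t²)^m`. -/
theorem integral_sqrt_mul_wave {m : ℕ} (hm : 1 ≤ m) (hF : Module.finrank ℝ F = 2 * m)
    {ψ : ℝ → ℝ} (hψ : Continuous ψ) {z : F} (hz : z ≠ 0) :
    ∫ ω : F, √(1 - ‖ω‖ ^ 2) * ψ (inner ℝ z ω) =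
      (∫ w : EuclideanSpace ℝ (Fin (2 * m - 1)), √(1 - ‖w‖ ^ 2)) *
        ∫ t in (-1 : ℝ)..1, (1 - t ^ 2) ^ m * ψ (‖z‖ * t) := by
  have hz0 : ‖z‖ ≠ 0 := norm_ne_zero_iff.2 hz
  obtain ⟨T, hT, hTp⟩ := exists_measurableEquiv_prod_inner (d := 2 * m - 1) (by omega)
    (e := ‖z‖⁻¹ • z) (norm_smul_inv_norm hz)
  have hin : ∀ p, inner ℝ z (T p) = ‖z‖ * p.1 := fun p => by
    rw [← (hTp p).2, inner_smul_left]
    simp [hz0]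
  rw [← hT.integral_comp' (g := fun ω => √(1 - ‖ω‖ ^ 2) * ψ (inner ℝ z ω))]
  simp_rw [hin, (hTp _).1, ← sub_sub]
  have hint : Integrable (fun p : ℝ × EuclideanSpace ℝ (Fin (2 * m - 1)) =>
      √(1 - p.1 ^ 2 - ‖p.2‖ ^ 2) * ψ (‖z‖ * p.1)) := by
    refine Continuous.integrable_of_hasCompactSupport (by fun_prop)
      (HasCompactSupport.intro (isCompact_closedBall 0 1) fun p hp => ?_)
    have hp1 : 1 < ‖p‖ := by simpa using hp
    rw [Real.sqrt_eq_zero_of_nonpos, zero_mul]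
    rcases lt_max_iff.1 hp1 with h | h
    · rw [Real.norm_eq_abs] at h
      nlinarith [sq_abs p.1, sq_nonneg ‖p.2‖]
    · nlinarith [sq_nonneg p.1]
  rw [Measure.volume_eq_prod, integral_prod _ hint]
  simp_rw [integral_mul_const, integral_sqrt_one_sub_sq_sub_norm_sq hm]
  rw [intervalIntegral.integral_of_le (by norm_num), integral_Ioc_eq_integral_Ioo,
    ← integral_indicator measurableSet_Ioo, ← integral_const_mul]
  refine integral_congr_ae (Filter.Eventually.of_forall fun t => ?_)
  by_cases ht : t ∈ Set.Ioo (-1 : ℝ) 1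
  · simp only [Set.indicator_of_mem ht]
    ring
  · simp only [Set.indicator_of_notMem ht]
    ring

/-- If all plane waves vanishing for `⟪z, ω⟫ ≤ 1`, with frequency `ω` in the unit ball, annihilate
`h`, then so do their averages over `ω`; these yield all radial bumps supported in `‖z‖ > 1`. -/
theorem integral_radial_bump_eq_zero {m : ℕ} (hm : 1 ≤ m) (hF : Module.finrank ℝ F = 2 * m)
    {Ω : Set F} (hΩ : ∀ᵐ ω : F, ‖ω‖ < 1 → ω ∈ Ω) {h : SchwartzMap F ℂ}
    (H : ∀ ψ, IsWaveProfile ψ → ∀ ω ∈ Ω, ∫ z, ψ (inner ℝ z ω) • h z = 0)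
    {β : ℝ → ℝ} (hβ : ContDiff ℝ (m + 1 : ℕ) β)
    (hc : HasCompactSupport β) (hs : tsupport β ⊆ Set.Ioi 1) :
    ∫ z, ((‖z‖ ^ (2 * m + 1))⁻¹ * β (‖z‖ ^ 2)) • h z = 0 := by
  obtain ⟨ψ, hψ, hψβ⟩ := exists_isWaveProfile_integral_eq hβ hc hs
  obtain ⟨b, hb, hle⟩ := hψ.exists_bound h 1
  set c := ∫ w : EuclideanSpace ℝ (Fin (2 * m - 1)), √(1 - ‖w‖ ^ 2)
  have hc0 : 0 < c := integral_sqrt_one_sub_norm_sq_pos _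
  have hw : ∀ ω : F, ¬ ‖ω‖ < 1 → √(1 - ‖ω‖ ^ 2) = 0 := fun ω hω =>
    Real.sqrt_eq_zero_of_nonpos (by nlinarith)
  have hwi : Integrable fun ω : F => √(1 - ‖ω‖ ^ 2) :=
    Continuous.integrable_of_hasCompactSupport (by fun_prop)
      (HasCompactSupport.intro (isCompact_closedBall 0 1) fun ω hω =>
        hw ω (by simpa using (by simpa using hω : 1 < ‖ω‖).le))
  have hint : Integrable (fun p : F × F => (√(1 - ‖p.1‖ ^ 2) * ψ (inner ℝ p.2 p.1)) • h p.2)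
      (volume.prod volume) := by
    refine (hwi.mul_prod hb).mono' (Continuous.aestronglyMeasurable ?_)
      (Filter.Eventually.of_forall fun p => ?_)
    · have := hψ.continuous
      have := h.continuous
      fun_prop
    · by_cases hp : ‖p.1‖ < 1
      · rw [mul_smul, norm_smul, Real.norm_of_nonneg (Real.sqrt_nonneg _)]
        gcongr
        exact hle _ _ hp.le
      · simp [hw _ hp]
  have hswap := integral_integral_swap
    (f := fun ω z : F => (√(1 - ‖ω‖ ^ 2) * ψ (inner ℝ z ω)) • h z) hint
  have hleft : ∫ ω, ∫ z, (√(1 - ‖ω‖ ^ 2) * ψ (inner ℝ z ω)) • h z = 0 := by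
    rw [integral_eq_zero_of_ae]
    filter_upwards [hΩ] with ω hω
    by_cases h1 : ‖ω‖ < 1
    · simp_rw [mul_smul]
      rw [integral_smul, H ψ hψ ω (hω h1), smul_zero]
      rfl
    · simp [hw _ h1]
  rw [hleft] at hswap
  have hz : ∀ z : F, z ≠ 0 → ∫ ω, (√(1 - ‖ω‖ ^ 2) * ψ (inner ℝ z ω)) • h z =
      (c * m.factorial) • (((‖z‖ ^ (2 * m + 1))⁻¹ * β (‖z‖ ^ 2)) • h z) := fun z hz => by
    rw [integral_smul_const, integral_sqrt_mul_wave hm hF hψ.continuous hz,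
      hψβ _ (norm_pos_iff.2 hz), smul_smul]
    congr 1
    ring
  have hnt : Nontrivial F := Module.nontrivial_of_finrank_pos (R := ℝ) (by omega)
  have hae : ∀ᵐ z : F, z ≠ 0 := by
    simp [ae_iff, measure_singleton]
  rw [integral_congr_ae (hae.mono hz), integral_smul] at hswap
  have : c * (m.factorial : ℝ) ≠ 0 := by positivity
  exact (smul_eq_zero.1 hswap.symm).resolve_left this

/-- The support theorem for the Radon transform of Schwartz functions in even dimension, with the
hypothesis in terms of plane waves: if `h` is annihilated by all plane waves `ψ ⟪·, ω⟫` supported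
in half spaces that miss the closed unit ball, then `h` vanishes outside the unit ball. It suffices
to know this for almost all `ω`. -/
theorem schwartzMap_eq_zero_of_forall_wave_eq_zero {m : ℕ} (hm : 1 ≤ m)
    (hF : Module.finrank ℝ F = 2 * m)
    {Ω : Set F} (hΩo : IsOpen Ω) (hΩ : ∀ᵐ ω : F, ‖ω‖ < 1 → ω ∈ Ω) {h : SchwartzMap F ℂ}
    (H : ∀ ψ, IsWaveProfile ψ → ∀ ω ∈ Ω, ∫ z, ψ (inner ℝ z ω) • h z = 0)
    {z₀ : F} (hz₀ : 1 < ‖z₀‖) : h z₀ = 0 := by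
  have h1 : 0 < ‖z₀‖ ^ 2 - 1 := by nlinarith
  let β : ContDiffBump (‖z₀‖ ^ 2) :=
    ⟨(‖z₀‖ ^ 2 - 1) / 3, (‖z₀‖ ^ 2 - 1) / 2, by linarith, by linarith⟩
  have hs : tsupport β ⊆ Set.Ioi 1 := by
    rw [β.tsupport_eq]
    intro x hx
    rw [Metric.mem_closedBall, Real.dist_eq] at hx
    have := (abs_le.1 hx).1
    have h2 : β.rOut = (‖z₀‖ ^ 2 - 1) / 2 := rfl
    rw [h2] at this
    rw [Set.mem_Ioi]
    linarith
  -- The bump equals `1` on the sphere through `z₀` and vanishes near the closed unit ball, so the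
  -- singularity of the negative power of `‖z‖` at the origin does not matter.
  let Φ : F → ℝ := fun z => (‖z‖ ^ (2 * m + 1))⁻¹ * β (‖z‖ ^ 2)
  have hΦc : Continuous Φ := by
    refine continuous_iff_continuousAt.2 fun z => ?_
    by_cases hz : z = 0
    · have h0 : Φ =ᶠ[nhds z] fun _ => 0 := by
        filter_upwards [Metric.ball_mem_nhds z one_pos] with x hx
        rw [hz, mem_ball_zero_iff] at hx
        have : β (‖x‖ ^ 2) = 0 := image_eq_zero_of_notMem_tsupport fun hmem => by
          have := hs hmem
          rw [Set.mem_Ioi] at this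
          nlinarith [norm_nonneg x]
        simp [Φ, this]
      exact continuousAt_const.congr h0.symm
    · refine ContinuousAt.mul (ContinuousAt.inv₀ (by fun_prop) ?_) ?_
      · exact pow_ne_zero _ (norm_ne_zero_iff.2 hz)
      · exact (β.continuous.comp (by fun_prop)).continuousAt
  have hΦs : HasCompactSupport Φ := by
    refine HasCompactSupport.intro (isCompact_closedBall 0 (2 * ‖z₀‖)) fun z hz => ?_
    have hz1 : 2 * ‖z₀‖ < ‖z‖ := by simpa using hz
    have : β (‖z‖ ^ 2) = 0 := β.zero_of_le_dist (by
      have h2 : β.rOut = (‖z₀‖ ^ 2 - 1) / 2 := rfl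
      rw [h2, Real.dist_eq]
      refine le_trans ?_ (le_abs_self _)
      nlinarith)
    simp [Φ, this]
  have hG : (fun z => Φ z • h z) = 0 := by
    refine eq_zero_of_forall_integral_inner_pow_eq_zero
      (hΦc.smul h.continuous) (hΦs.smul_right) fun ξ k => ?_
    obtain ⟨g, hg⟩ := exists_schwartzMap_inner_pow_smul h ξ k
    have := integral_radial_bump_eq_zero hm hF hΩ (h := g)
      (fun ψ hψ ω hω => integral_wave_inner_pow_smul_eq_zero hΩo H ξ k hg hψ hω)
      β.contDiff β.hasCompactSupport hs
    rw [← this]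
    refine integral_congr_ae (Filter.Eventually.of_forall fun z => ?_)
    simp only [hg, Φ, Complex.real_smul]
    push_cast
    ring
  have h0 := congrFun hG z₀
  have hβ1 : β (‖z₀‖ ^ 2) = 1 := β.one_of_mem_closedBall (Metric.mem_closedBall_self β.rIn_pos.le)
  have hΦ0 : Φ z₀ ≠ 0 := by
    simp only [Φ, hβ1, mul_one]
    positivity
  exact (smul_eq_zero.1 h0).resolve_left hΦ0

end Average

/-! ### Polar coordinates -/

/-- Integration in polar coordinates with an iterated integral on the right. -/
theorem integral_eq_integral_toSphere_integral_Ioi {E : Type*} [NormedAddCommGroup E]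
    [NormedSpace ℝ E] [FiniteDimensional ℝ E] [Nontrivial E] [MeasurableSpace E] [BorelSpace E]
    (μ : Measure E) [μ.IsAddHaarMeasure] {G : E → ℂ} (hG : Integrable G μ) :
    ∫ y, G y ∂μ = ∫ θ : Metric.sphere (0 : E) 1, (∫ z in Set.Ioi (0 : ℝ),
      G (z • (θ : E)) * (z : ℂ) ^ (Module.finrank ℝ E - 1)) ∂μ.toSphere := by
  have hmp := μ.measurePreserving_homeomorphUnitSphereProd
  have hemb := (homeomorphUnitSphereProd E).measurableEmbedding
  have hval : ∀ x : ({0}ᶜ : Set E), G x = (fun p : Metric.sphere (0 : E) 1 × Set.Ioi (0 : ℝ) =>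
      G ((p.2 : ℝ) • (p.1 : E))) (homeomorphUnitSphereProd E x) := fun x => by
    have hx : ‖(x : E)‖ ≠ 0 := norm_ne_zero_iff.2 x.2
    simp [smul_smul, mul_inv_cancel₀ hx]
  have hint : Integrable (fun p : Metric.sphere (0 : E) 1 × Set.Ioi (0 : ℝ) =>
      G ((p.2 : ℝ) • (p.1 : E)))
      (μ.toSphere.prod (Measure.volumeIoiPow (Module.finrank ℝ E - 1))) := by
    rw [← hmp.integrable_comp_emb hemb]
    refine Integrable.congr ?_ (Filter.Eventually.of_forall hval)
    exact (integrableOn_iff_comap_subtypeVal (measurableSet_singleton _).compl).1 hG.integrableOn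
  calc ∫ y, G y ∂μ = ∫ x : ({0}ᶜ : Set E), G x ∂(μ.comap (↑)) := by
        rw [integral_subtype_comap (measurableSet_singleton _).compl, restrict_compl_singleton]
    _ = _ := by
        simp_rw [hval]
        rw [hmp.integral_comp hemb (fun p : Metric.sphere (0 : E) 1 × Set.Ioi (0 : ℝ) =>
          G ((p.2 : ℝ) • (p.1 : E))), integral_prod _ hint]
        refine integral_congr_ae (Filter.Eventually.of_forall fun θ => ?_)
        simp only [Measure.volumeIoiPow, ENNReal.ofReal]
        rw [integral_withDensity_eq_integral_smul
            ((measurable_subtype_coe.pow_const _).real_toNNReal),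
          integral_subtype_comap measurableSet_Ioi fun a : ℝ =>
            Real.toNNReal (a ^ (Module.finrank ℝ E - 1)) • G (a • (θ : E))]
        refine setIntegral_congr_fun measurableSet_Ioi fun z hz => ?_
        rw [NNReal.smul_def, Real.coe_toNNReal _ (pow_nonneg (le_of_lt hz) _), Complex.real_smul,
          mul_comm]
        push_cast
        rfl

/-! ### The cone transform -/

/-- The linear shear `(u, y) ↦ (u + s y, y)`. -/
noncomputable def shearEquiv (V : Type*) [NormedAddCommGroup V] [NormedSpace ℝ V]
    [FiniteDimensional ℝ V] (s : ℝ) : (V × V) ≃L[ℝ] (V × V) :=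
  LinearEquiv.toContinuousLinearEquiv
    { toFun := fun p => (p.1 + s • p.2, p.2)
      invFun := fun p => (p.1 - s • p.2, p.2)
      map_add' := fun p q => by
        ext1
        · simp only [Prod.fst_add, Prod.snd_add, smul_add]
          abel
        · rfl
      map_smul' := fun c p => by
        ext1
        · simp only [Prod.smul_fst, Prod.smul_snd, smul_add, RingHom.id_apply, smul_comm s c]
        · rfl
      left_inv := fun p => by simp
      right_inv := fun p => by simp }

@[simp]
theorem shearEquiv_apply {V : Type*} [NormedAddCommGroup V] [NormedSpace ℝ V]
    [FiniteDimensional ℝ V] (s : ℝ) (p : V × V) :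
    shearEquiv V s p = (p.1 + s • p.2, p.2) := rfl

section Cone

variable {V : Type*} [NormedAddCommGroup V] [InnerProductSpace ℝ V] [FiniteDimensional ℝ V]
  [MeasurableSpace V] [BorelSpace V]

theorem exists_linearIsometryEquiv_apply_eq {V : Type*} [NormedAddCommGroup V]
    [InnerProductSpace ℝ V] {v w : V} (h : ‖v‖ = ‖w‖) : ∃ U : V ≃ₗᵢ[ℝ] V, U v = w :=
  ⟨_, Submodule.reflection_sub h⟩

/-- A Schwartz function on `V × V` transported to the Euclidean (`L²`) product. -/
noncomputable def SchwartzMap.onEuclideanProd {V : Type*} [NormedAddCommGroup V]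
    [InnerProductSpace ℝ V] (f : SchwartzMap (V × V) ℂ) :
    SchwartzMap (WithLp 2 (V × V)) ℂ :=
  SchwartzMap.compCLMOfContinuousLinearEquiv ℂ (WithLp.prodContinuousLinearEquiv 2 ℝ V V) f

theorem SchwartzMap.onEuclideanProd_toLp {V : Type*} [NormedAddCommGroup V]
    [InnerProductSpace ℝ V] (f : SchwartzMap (V × V) ℂ) (p : V × V) :
    f.onEuclideanProd (WithLp.toLp 2 p) = f p := rfl

theorem IsWaveProfile.integrable_prod {ψ : ℝ → ℝ} (hψ : IsWaveProfile ψ)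
    (f : SchwartzMap (V × V) ℂ) (a b : V) :
    Integrable fun p : V × V => ψ (inner ℝ p.1 a + inner ℝ p.2 b) • f p := by
  have := (WithLp.volume_preserving_toLp V V).integrable_comp_emb
    (MeasurableEquiv.toLp 2 (V × V)).measurableEmbedding |>.2
    (hψ.integrable_smul f.onEuclideanProd (WithLp.toLp 2 (a, b)))
  exact this

theorem integral_onEuclideanProd_wave (ψ : ℝ → ℝ)
    (f : SchwartzMap (V × V) ℂ) (ω : WithLp 2 (V × V)) :
    ∫ z, ψ (inner ℝ z ω) • f.onEuclideanProd z =
      ∫ p : V × V, ψ (inner ℝ p.1 ω.fst + inner ℝ p.2 ω.snd) • f p := by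
  rw [← (WithLp.volume_preserving_toLp V V).integral_comp
    (MeasurableEquiv.toLp 2 (V × V)).measurableEmbedding]
  rfl

/-- The projection-slice relation: integrating the cone transform against a wave in `u` gives the
plane wave integral of `f`, with frequency rotated so that the parts in the two variables are
parallel. -/
theorem integral_wave_eq_integral_wave_cone {ψ : ℝ → ℝ} (hψ : IsWaveProfile ψ)
    {f : SchwartzMap (V × V) ℂ} (hf : ∀ (U : V ≃ₗᵢ[ℝ] V) (x y : V), f (x, y) = f (x, U y))
    {a b : V} {s : ℝ} (hs : 0 ≤ s) (hab : ‖b‖ = s * ‖a‖) :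
    ∫ p : V × V, ψ (inner ℝ p.1 a + inner ℝ p.2 b) • f p =
      ∫ u, ψ (inner ℝ u a) • ∫ y, f (u + s • y, y) := by
  -- A rotation of the second variable makes `b` parallel to `a`, and the wave depends on `x - s y`.
  obtain ⟨U, hU⟩ := exists_linearIsometryEquiv_apply_eq (v := -(s • a)) (w := b)
    (by rw [norm_neg, norm_smul, hab, Real.norm_of_nonneg hs])
  have hin : ∀ y, inner ℝ (U y) b = -(s * inner ℝ y a) := fun y => by
    rw [← hU, LinearIsometryEquiv.inner_map_map, inner_neg_right, inner_smul_right]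
  have hint := hψ.integrable_prod
    (SchwartzMap.compCLMOfContinuousLinearEquiv ℂ (shearEquiv V s) f) a 0
  simp only [inner_zero_right, add_zero] at hint
  rw [Measure.volume_eq_prod] at hint
  rw [Measure.volume_eq_prod, integral_prod_symm _ (hψ.integrable_prod f a b),
    ← U.measurePreserving.integral_comp U.toMeasurableEquiv.measurableEmbedding]
  simp_rw [← integral_smul]
  rw [integral_integral_swap (f := fun u y => ψ (inner ℝ u a) • f (u + s • y, y)) hint]
  refine integral_congr_ae (Filter.Eventually.of_forall fun y => ?_)
  simp only [hin, ← hf U]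
  rw [← integral_add_right_eq_self _ (s • y)]
  simp [inner_add_left, inner_smul_left]

theorem one_lt_norm_mul_norm_of_wave_ne_zero {V : Type*} [NormedAddCommGroup V]
    [InnerProductSpace ℝ V] {ψ : ℝ → ℝ} (hψ : IsWaveProfile ψ)
    {u a : V} (h : ψ (inner ℝ u a) ≠ 0) : 1 < ‖u‖ * ‖a‖ := by
  by_contra hle
  exact h (hψ.eq_zero _ ((real_inner_le_norm u a).trans (not_lt.1 hle)))

/-- The affine subspace `{(u + s y, y)}` of `V × V` misses the closed unit ball if
`‖u‖ > √(1 + s²)`. -/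
theorem one_lt_norm_add_smul_sq_add_norm_sq {V : Type*} [NormedAddCommGroup V]
    [InnerProductSpace ℝ V] {u y : V} {s : ℝ} (hs : 0 ≤ s)
    (hu : √(1 + s ^ 2) < ‖u‖) : 1 < ‖u + s • y‖ ^ 2 + ‖y‖ ^ 2 := by
  rw [Real.sqrt_lt (by positivity) (norm_nonneg u)] at hu
  have h1 : ‖u‖ ≤ ‖u + s • y‖ + s * ‖y‖ := by
    calc ‖u‖ = ‖(u + s • y) - s • y‖ := by rw [add_sub_cancel_right]
      _ ≤ ‖u + s • y‖ + ‖s • y‖ := norm_sub_le _ _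
      _ = _ := by rw [norm_smul, Real.norm_of_nonneg hs]
  have h2 : ‖u‖ ^ 2 ≤ (‖u + s • y‖ + s * ‖y‖) ^ 2 := by gcongr
  have h3 : (‖u + s • y‖ + s * ‖y‖) ^ 2 ≤ (1 + s ^ 2) * (‖u + s • y‖ ^ 2 + ‖y‖ ^ 2) := by
    nlinarith [sq_nonneg (s * ‖u + s • y‖ - ‖y‖)]
  have h4 : (0 : ℝ) < 1 + s ^ 2 := by positivity
  nlinarith

/-- The support theorem for the cone transform, over a Euclidean space `V`. The hypothesis gives the
plane waves of frequency `ω = (a, b)` with `a ≠ 0` only; these are almost all frequencies. -/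
theorem eq_zero_of_forall_integral_cone_eq_zero [Nontrivial V] {f : SchwartzMap (V × V) ℂ}
    (hf : ∀ (U : V ≃ₗᵢ[ℝ] V) (x y : V), f (x, y) = f (x, U y))
    (h : ∀ (u : V) (s : ℝ), 0 ≤ s → √(1 + s ^ 2) < ‖u‖ → ∫ y, f (u + s • y, y) = 0)
    {x y : V} (hxy : 1 < ‖x‖ ^ 2 + ‖y‖ ^ 2) : f (x, y) = 0 := by
  let Ω : Set (WithLp 2 (V × V)) := {ω | ‖ω‖ < 1 ∧ ω.fst ≠ 0}
  have hfst : Continuous fun ω : WithLp 2 (V × V) => ω.fst :=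
    continuous_fst.comp (WithLp.prod_continuous_ofLp 2 V V)
  have hΩo : IsOpen Ω :=
    (isOpen_lt continuous_norm continuous_const).inter (isOpen_ne.preimage hfst)
  have hΩ : ∀ᵐ ω : WithLp 2 (V × V), ‖ω‖ < 1 → ω ∈ Ω := by
    let K : Submodule ℝ (WithLp 2 (V × V)) :=
      LinearMap.ker (LinearMap.fst ℝ V V ∘ₗ (WithLp.linearEquiv 2 ℝ (V × V)).toLinearMap)
    have hK : K ≠ ⊤ := by
      obtain ⟨e, he⟩ := exists_ne (0 : V)
      intro htop
      have : WithLp.toLp 2 (e, (0 : V)) ∈ K := htop ▸ Submodule.mem_top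
      exact he (by simpa [K] using this)
    have h0 := Measure.addHaar_submodule (volume : Measure (WithLp 2 (V × V))) K hK
    filter_upwards [measure_eq_zero_iff_ae_notMem.1 h0] with ω hω h1
    exact ⟨h1, fun h2 => hω (by simpa [K] using h2)⟩
  have hdim : Module.finrank ℝ (WithLp 2 (V × V)) = 2 * Module.finrank ℝ V := by
    rw [LinearEquiv.finrank_eq (WithLp.linearEquiv 2 ℝ (V × V)), Module.finrank_prod, two_mul]
  rw [← f.onEuclideanProd_toLp]
  refine schwartzMap_eq_zero_of_forall_wave_eq_zero Module.finrank_pos hdim hΩo hΩ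
    (fun ψ hψ ω hω => ?_) ?_
  · have ha : 0 < ‖ω.fst‖ := norm_pos_iff.2 hω.2
    set s := ‖ω.snd‖ / ‖ω.fst‖ with hs
    have hs0 : 0 ≤ s := by positivity
    have hsa : ‖ω.snd‖ = s * ‖ω.fst‖ := by rw [hs, div_mul_cancel₀ _ ha.ne']
    rw [integral_onEuclideanProd_wave, integral_wave_eq_integral_wave_cone hψ hf hs0 hsa]
    rw [integral_eq_zero_of_ae]
    refine Filter.Eventually.of_forall fun u => ?_
    -- On the support of the wave `‖u‖ > 1 / ‖a‖`, which is at least `√(1 + s²)` as `‖ω‖ < 1`.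
    by_cases hu : ψ (inner ℝ u ω.fst) = 0
    · simp [hu]
    have h1 := one_lt_norm_mul_norm_of_wave_ne_zero hψ hu
    have h2 : ‖ω‖ ^ 2 < 1 := by nlinarith [hω.1, norm_nonneg ω]
    rw [WithLp.prod_norm_sq_eq_of_L2] at h2
    simp only [Pi.zero_apply]
    rw [h u s hs0, smul_zero]
    rw [Real.sqrt_lt (by positivity) (norm_nonneg u)]
    refine lt_of_mul_lt_mul_right (a := ‖ω.fst‖ ^ 2) ?_ (by positivity)
    have h3 : (1 + s ^ 2) * ‖ω.fst‖ ^ 2 = ‖ω.fst‖ ^ 2 + ‖ω.snd‖ ^ 2 := by rw [hsa]; ring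
    rw [h3, ← mul_pow]
    have h4 : 1 < (‖u‖ * ‖ω.fst‖) ^ 2 := one_lt_pow₀ h1 two_ne_zero
    exact h2.trans h4
  · have : 1 < ‖WithLp.toLp 2 (x, y)‖ ^ 2 := by
      rw [WithLp.prod_norm_sq_eq_of_L2]
      exact hxy
    by_contra hle
    nlinarith [norm_nonneg (WithLp.toLp 2 (x, y))]

theorem SchwartzMap.integrable_cone (f : SchwartzMap (V × V) ℂ) (u : V) (s : ℝ) :
    Integrable fun y : V => f (u + s • y, y) := by
  have hr : (Module.finrank ℝ V : ℝ) < (Module.finrank ℝ V + 1 : ℕ) := by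
    push_cast
    linarith
  set N := Module.finrank ℝ V + 1
  set C := 2 ^ N * (Finset.Iic (N, 0)).sup (fun m => SchwartzMap.seminorm ℝ m.1 m.2) f
  refine ((integrable_one_add_norm hr).const_mul C).mono'
    (f.continuous.comp (by fun_prop)).aestronglyMeasurable
    (Filter.Eventually.of_forall fun y => ?_)
  have h1 := SchwartzMap.one_add_le_sup_seminorm_apply (𝕜 := ℝ) (m := (N, 0)) (k := N) (n := 0)
    le_rfl le_rfl f (u + s • y, y)
  rw [norm_iteratedFDeriv_zero] at h1
  have h2 : ‖y‖ ≤ ‖(u + s • y, y)‖ := norm_snd_le (u + s • y, y)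
  rw [Real.rpow_neg (by positivity), Real.rpow_natCast, ← div_eq_mul_inv, le_div_iff₀ (by positivity),
    mul_comm]
  refine le_trans ?_ h1
  gcongr

end Cone

theorem halfSpaceConeTransform_eq_integral_cone {n : ℕ} (hn : 2 ≤ n)
    {f : SchwartzMap (EucSpace n × EucSpace n) ℂ} {g : EucSpace n × ℝ → ℂ}
    (hg : ∀ x y : EucSpace n, g (x, ‖y‖) = f (x, y)) (u : EucSpace n) (s : ℝ) :
    halfSpaceConeTransform n g u s = ∫ y, f (u + s • y, y) := by
  have hfr : Module.finrank ℝ (EucSpace n) = n - 1 := finrank_euclideanSpace_fin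
  have : Nontrivial (EucSpace n) := Module.nontrivial_of_finrank_pos (R := ℝ) (by omega)
  rw [integral_eq_integral_toSphere_integral_Ioi volume (f.integrable_cone u s),
    halfSpaceConeTransform, hfr]
  refine integral_congr_ae (Filter.Eventually.of_forall fun θ => ?_)
  refine setIntegral_congr_fun measurableSet_Ioi fun z hz => ?_
  have hθ : ‖z • (θ : EucSpace n)‖ = z := by
    rw [norm_smul, mem_sphere_zero_iff_norm.1 θ.2, mul_one, Real.norm_of_nonneg (le_of_lt hz)]
  rw [← hg, hθ, smul_smul, mul_comm s z, Nat.sub_sub]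

theorem mainTheorem5 (n : ℕ) (hn : 2 ≤ n) (f : SchwartzMap (EucSpace n × EucSpace n) ℂ)
    (hf : f ∈ radialSchwartz n) :
    ((∀ u v : EucSpace n, √(1 + ‖v‖ ^ 2) < ‖u‖ → coneTransform n f u v = 0) ↔
      ∀ x y : EucSpace n, 1 < ‖x‖ ^ 2 + ‖y‖ ^ 2 → f (x, y) = 0) ∧
    ∀ g : EucSpace n × ℝ → ℂ, (∀ x y : EucSpace n, g (x, ‖y‖) = f (x, y)) →
      ((∀ (u : EucSpace n) (s : ℝ), 0 ≤ s → √(1 + s ^ 2) < ‖u‖ →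
          halfSpaceConeTransform n g u s = 0) ↔
        ∀ (x : EucSpace n) (z : ℝ), 0 ≤ z → 1 < ‖x‖ ^ 2 + z ^ 2 → g (x, z) = 0) := by
  have : Nontrivial (EucSpace n) := Module.nontrivial_of_finrank_pos (R := ℝ) (by
    rw [finrank_euclideanSpace_fin]
    omega)
  have hnorm : ∀ z : ℝ, 0 ≤ z → ∃ y : EucSpace n, ‖y‖ = z := fun z hz => exists_norm_eq _ hz
  have key : (∀ (u : EucSpace n) (s : ℝ), 0 ≤ s → √(1 + s ^ 2) < ‖u‖ →
      ∫ y, f (u + s • y, y) = 0) ↔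
      ∀ x y : EucSpace n, 1 < ‖x‖ ^ 2 + ‖y‖ ^ 2 → f (x, y) = 0 := by
    refine ⟨fun h x y hxy => eq_zero_of_forall_integral_cone_eq_zero hf h hxy,
      fun h u s hs hu => ?_⟩
    simp [fun y => h _ _ (one_lt_norm_add_smul_sq_add_norm_sq (y := y) hs hu)]
  refine ⟨?_, fun g hg => ?_⟩
  · rw [← key]
    constructor
    · intro h u s hs hu
      obtain ⟨v, rfl⟩ := hnorm s hs
      exact h u v hu
    · exact fun h u v hu => h u ‖v‖ (norm_nonneg v) hu
  · simp_rw [halfSpaceConeTransform_eq_integral_cone hn hg]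
    rw [key]
    constructor
    · intro h x z hz hxz
      obtain ⟨y, rfl⟩ := hnorm z hz
      rw [hg]
      exact h x y hxz
    · intro h x y hxy
      rw [← hg]
      exact h x ‖y‖ (norm_nonneg y) hxy
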